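/- **Setting.** Let $\mathrm{Pauli}_n$ be the $n$-qubit Pauli group, i.e. all operators $i^c\,\sigma_1\otimes\cdots\otimes\sigma_n$ with $c\in\mathbb Z$ and $\sigma_j\in\{I,X,Y,Z\}$. Let $\mathcal S\subset\mathrm{Pauli}_n$ be a stabilizer group (an abelian subgroup with $-I\notin\mathcal S$) whose code space $\{|\psi\rangle : U|\psi\rangle=|\psi\rangle\ \forall U\in\mathcal S\}$ encodes $k$ logical qubits, and let $\Xi:(\mathbb C^2)^{\otimes k}\to(\mathbb C^2)^{\otimes n}$ be an encoding isometry, i.e. an isometry whose range is the code space. For a subgroup $\mathcal H$ of $n$-qubit unitaries let $\mathcal C(\mathcal H)$ be the group of Pauli operators that commute with all elements of $\mathcal H$. The group of logical operators is $\mathcal L=\mathcal C(\mathcal S)$; a logical operator is non-trivial if it is not in $\mathcal S$, and $\ell'\sim\ell$ means $\ell'=\ell U$ for some $U\in\mathcal S$. Let $P_1,\dots,P_m$ be mutually commuting Hermitian operators in $\mathrm{Pauli}_n$, let $m_1,\dots,m_m\in\{\pm1\}$ be measurement outcomes, and put $M_j=m_jP_j$ and $\mathcal M=\langle M_1,\dots,M_m\rangle$.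 Let $|\Phi\rangle=(\Xi\otimes I)|\mathrm{EPR}\rangle^{\otimes k}$ be the Choi state on the system $A$ ($n$ qubits) and the reference $R$ ($k$ qubits), where $|\mathrm{EPR}\rangle=(|00\rangle+|11\rangle)/\sqrt2$. Assume that the outcomes are possible, i.e. $\big(\prod_j\tfrac{I+M_j}{2}\otimes I\big)|\Phi\rangle\neq0$, and let $|\Phi'\rangle$ be the normalization of this vector (the post-measurement Choi state). Let $I(A,R)=S_A+S_R-S_{AR}$ be the mutual information of $|\Phi'\rangle$, where $S_B=-\mathrm{Tr}(\rho_B\log_2\rho_B)$ is the von Neumann entropy of the reduced state $\rho_B$ on $B$. **Theorem.** The following three statements are equivalent: (i) $\mathcal M$ contains no non-trivial logical operator, i.e. $\mathcal M\cap\mathcal L\subseteq\mathcal S$. (ii) For every non-trivial logical operator $\ell\in\mathcal L\setminus\mathcal S$ there is an equivalent logical operator $\ell'\sim\ell$ that commutes with $\mathcal M$, i.e. $\ell'\in\mathcal C(\mathcal M)$. (iii) The code retains the encoded information after the measurements, i.e. $I(A,R)=2k$ in the post-measurement Choi state. -/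

import Mathlib

open scoped Kronecker

namespace MonitoredCodes

noncomputable section

/-- Computational basis labels (bit strings) of `n` qubits. -/
abbrev Bits (n : ℕ) := Fin n → Fin 2

/-- Linear operators on `n` qubits, written in the computational basis. -/
abbrev Op (n : ℕ) := Matrix (Bits n) (Bits n) ℂ

/-- The group of unitary operators on `n` qubits. -/
abbrev QubitUnitary (n : ℕ) := Matrix.unitaryGroup (Bits n) ℂ

/-! ### Pauli operators -/

def sigmaX : Matrix (Fin 2) (Fin 2) ℂ := !![0, 1; 1, 0]

def sigmaY : Matrix (Fin 2) (Fin 2) ℂ := !![0, -Complex.I; Complex.I, 0]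

def sigmaZ : Matrix (Fin 2) (Fin 2) ℂ := !![1, 0; 0, -1]

/-- The four single-qubit Pauli matrices. -/
def singlePaulis : Set (Matrix (Fin 2) (Fin 2) ℂ) := {1, sigmaX, sigmaY, sigmaZ}

/-- The tensor product of single-qubit operators, one for each of the `n` qubits. -/
def tensorOp {n : ℕ} (σ : Fin n → Matrix (Fin 2) (Fin 2) ℂ) : Op n :=
  Matrix.of fun x y => ∏ j, σ j (x j) (y j)

theorem tensorOp_mul {n : ℕ} (σ τ : Fin n → Matrix (Fin 2) (Fin 2) ℂ) :
    tensorOp σ * tensorOp τ = tensorOp fun j => σ j * τ j := by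
  ext x y
  simp only [tensorOp, Matrix.mul_apply, Matrix.of_apply, ← Finset.prod_mul_distrib]
  rw [Finset.prod_univ_sum]
  simp

theorem tensorOp_one {n : ℕ} :
    tensorOp (fun _ : Fin n => (1 : Matrix (Fin 2) (Fin 2) ℂ)) = 1 := by
  ext x y
  simp only [tensorOp, Matrix.of_apply, Matrix.one_apply, Finset.prod_ite_zero, funext_iff]
  simp

theorem tensorOp_smul {n : ℕ} (c : Fin n → ℂ) (σ : Fin n → Matrix (Fin 2) (Fin 2) ℂ) :
    tensorOp (fun j => c j • σ j) = (∏ j, c j) • tensorOp σ := by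
  ext x y
  simp [tensorOp, Finset.prod_mul_distrib]

theorem tensorOp_star {n : ℕ} (σ : Fin n → Matrix (Fin 2) (Fin 2) ℂ) :
    star (tensorOp σ) = tensorOp fun j => star (σ j) := by
  ext x y
  simp [tensorOp, Matrix.star_apply]

theorem singlePaulis_mul {σ τ : Matrix (Fin 2) (Fin 2) ℂ}
    (hσ : σ ∈ singlePaulis) (hτ : τ ∈ singlePaulis) :
    ∃ c : ℕ, ∃ ρ ∈ singlePaulis, σ * τ = Complex.I ^ c • ρ := by
  have h3 : Complex.I ^ 3 = -Complex.I := Complex.I_pow_three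
  rcases hσ with rfl | rfl | rfl | rfl
  · exact ⟨0, τ, hτ, by simp⟩
  · rcases hτ with rfl | rfl | rfl | rfl
    · exact ⟨0, sigmaX, by simp [singlePaulis], by simp⟩
    · exact ⟨0, 1, by simp [singlePaulis], by
        ext i j; fin_cases i <;> fin_cases j <;> simp [sigmaX]⟩
    · exact ⟨1, sigmaZ, by simp [singlePaulis], by
        ext i j; fin_cases i <;> fin_cases j <;> simp [sigmaX, sigmaY, sigmaZ]⟩
    · exact ⟨3, sigmaY, by simp [singlePaulis], by
        ext i j; fin_cases i <;> fin_cases j <;> simp [sigmaX, sigmaY, sigmaZ, h3]⟩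
  · rcases hτ with rfl | rfl | rfl | rfl
    · exact ⟨0, sigmaY, by simp [singlePaulis], by simp⟩
    · exact ⟨3, sigmaZ, by simp [singlePaulis], by
        ext i j; fin_cases i <;> fin_cases j <;> simp [sigmaX, sigmaY, sigmaZ, h3]⟩
    · exact ⟨0, 1, by simp [singlePaulis], by
        ext i j; fin_cases i <;> fin_cases j <;> simp [sigmaY]⟩
    · exact ⟨1, sigmaX, by simp [singlePaulis], by
        ext i j; fin_cases i <;> fin_cases j <;> simp [sigmaX, sigmaY, sigmaZ]⟩
  · rcases hτ with rfl | rfl | rfl | rfl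
    · exact ⟨0, sigmaZ, by simp [singlePaulis], by simp⟩
    · exact ⟨1, sigmaY, by simp [singlePaulis], by
        ext i j; fin_cases i <;> fin_cases j <;> simp [sigmaX, sigmaY, sigmaZ]⟩
    · exact ⟨3, sigmaX, by simp [singlePaulis], by
        ext i j; fin_cases i <;> fin_cases j <;> simp [sigmaX, sigmaY, sigmaZ, h3]⟩
    · exact ⟨0, 1, by simp [singlePaulis], by
        ext i j; fin_cases i <;> fin_cases j <;> simp [sigmaZ]⟩

theorem singlePaulis_star {σ : Matrix (Fin 2) (Fin 2) ℂ} (hσ : σ ∈ singlePaulis) :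
    star σ = σ := by
  rcases hσ with rfl | rfl | rfl | rfl
  · simp
  all_goals
    ext i j
    fin_cases i <;> fin_cases j <;> simp [sigmaX, sigmaY, sigmaZ, Matrix.star_apply]

/-- The Pauli group `Pauli` on `n` qubits: all `i ^ c • (σ₁ ⊗ ⋯ ⊗ σₙ)` with every `σⱼ` one of
`I`, `X`, `Y`, `Z`. -/
def pauliGroup (n : ℕ) : Subgroup (QubitUnitary n) where
  carrier := {U | ∃ (c : ℕ) (σ : Fin n → Matrix (Fin 2) (Fin 2) ℂ),
    (∀ j, σ j ∈ singlePaulis) ∧ (U : Op n) = Complex.I ^ c • tensorOp σ}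
  one_mem' := ⟨0, fun _ => 1, fun _ => by simp [singlePaulis], by simp [tensorOp_one]⟩
  mul_mem' := by
    rintro U V ⟨c, σ, hσ, hU⟩ ⟨d, τ, hτ, hV⟩
    choose e ρ hρ h using fun j => singlePaulis_mul (hσ j) (hτ j)
    refine ⟨c + d + ∑ j, e j, ρ, hρ, ?_⟩
    rw [Submonoid.coe_mul, hU, hV, Matrix.smul_mul, Matrix.mul_smul, tensorOp_mul, funext h,
      tensorOp_smul, Finset.prod_pow_eq_pow_sum, smul_smul, smul_smul, pow_add, pow_add]
  inv_mem' := by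
    rintro U ⟨c, σ, hσ, hU⟩
    refine ⟨3 * c, σ, hσ, ?_⟩
    rw [Matrix.UnitaryGroup.inv_val, hU, star_smul, tensorOp_star,
      funext fun j => singlePaulis_star (hσ j), pow_mul, Complex.I_pow_three]
    simp

/-! ### Stabilizer codes -/

/-- `S` is a stabilizer group: an abelian group of Pauli operators that does not contain `-I`. -/
structure IsStabilizerGroup {n : ℕ} (S : Subgroup (QubitUnitary n)) : Prop where
  le_pauliGroup : S ≤ pauliGroup n
  comm : ∀ U ∈ S, ∀ V ∈ S, U * V = V * U
  neg_one_notMem : (-1 : QubitUnitary n) ∉ S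

/-- The code space: the states `ψ` with `U ψ = ψ` for all `U ∈ S`. -/
def codeSpace {n : ℕ} (S : Subgroup (QubitUnitary n)) : Submodule ℂ (Bits n → ℂ) where
  carrier := {ψ | ∀ U ∈ S, (U : Op n).mulVec ψ = ψ}
  add_mem' := fun {ψ φ} hψ hφ U hU => by rw [Matrix.mulVec_add, hψ U hU, hφ U hU]
  zero_mem' := fun U _ => Matrix.mulVec_zero _
  smul_mem' := fun c ψ hψ U hU => by rw [Matrix.mulVec_smul, hψ U hU]

/-- `Ξ` is an encoding isometry of `k` logical qubits into the stabilizer code of `S`: an isometry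
from `k` qubits to `n` qubits whose range is the code space. -/
structure IsEncodingIsometry {n k : ℕ} (S : Subgroup (QubitUnitary n))
    (Ξ : Matrix (Bits n) (Bits k) ℂ) : Prop where
  isometry : Ξ.conjTranspose * Ξ = 1
  range_eq : LinearMap.range Ξ.mulVecLin = codeSpace S

/-- The centralizer `𝒞(H)` of `H` in the Pauli group: the Pauli operators that commute with every
element of `H`. -/
def pauliCentralizer {n : ℕ} (H : Subgroup (QubitUnitary n)) : Subgroup (QubitUnitary n) :=
  pauliGroup n ⊓ Subgroup.centralizer (H : Set (QubitUnitary n))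

/-- The group `ℒ` of Pauli logical operators of the code: the Pauli operators commuting with `S`.
(The elements of `S` are the trivial logical operators.) -/
def logicalGroup {n : ℕ} (S : Subgroup (QubitUnitary n)) : Subgroup (QubitUnitary n) :=
  pauliCentralizer S

/-- Equivalence `ℓ' ∼ ℓ` of logical operators: they differ by a stabilizer operator. -/
def LogicalEquiv {n : ℕ} (S : Subgroup (QubitUnitary n)) (ℓ' ℓ : QubitUnitary n) : Prop :=
  ∃ U ∈ S, ℓ' = ℓ * U

/-! ### Pauli measurements -/

/-- The measured Pauli operators `Mⱼ = mⱼ Pⱼ`, where `mⱼ = ±1` is the outcome of the measurement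
of `Pⱼ`. -/
def measuredOp {n m : ℕ} (P : Fin m → QubitUnitary n) (outcome : Fin m → ℤˣ) (j : Fin m) :
    QubitUnitary n :=
  if outcome j = 1 then P j else -P j

/-- The measured Pauli operator group `ℳ = ⟨M₁, …, Mₘ⟩`. -/
def measuredGroup {n m : ℕ} (M : Fin m → QubitUnitary n) : Subgroup (QubitUnitary n) :=
  Subgroup.closure (Set.range M)

/-- The product of the projectors `(I + Mⱼ) / 2` onto the `+1` eigenspaces of the `Mⱼ`. -/
def measurementProj {n m : ℕ} (M : Fin m → QubitUnitary n) : Op n :=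
  (List.ofFn fun j => (1 / 2 : ℂ) • (1 + (M j : Op n))).prod

/-! ### The Choi state, before and after the measurement -/

/-- `k` EPR pairs `|EPR⟩ = (|00⟩ + |11⟩) / √2`, the first factor holding the first halves and the
second factor the second halves of the pairs. -/
def eprPairs (k : ℕ) : Bits k × Bits k → ℂ :=
  fun p => ∏ j, if p.1 j = p.2 j then 1 / (Real.sqrt 2 : ℂ) else 0

/-- The Choi state `(Ξ ⊗ I) |EPR⟩^{⊗ k}`, on the system `A` (first factor) and the reference `R`
(second factor). -/
def choiState {n k : ℕ} (Ξ : Matrix (Bits n) (Bits k) ℂ) : Bits n × Bits k → ℂ :=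
  (Ξ ⊗ₖ (1 : Op k)).mulVec (eprPairs k)

/-- The unnormalized Choi state after the measurement of `A` has projected onto the `+1`
eigenspaces of the `Mⱼ`. -/
def projectedChoi {n k m : ℕ} (Ξ : Matrix (Bits n) (Bits k) ℂ) (M : Fin m → QubitUnitary n) :
    Bits n × Bits k → ℂ :=
  (measurementProj M ⊗ₖ (1 : Op k)).mulVec (choiState Ξ)

/-- The Euclidean norm of a state vector, squared. -/
def sqNorm {ι : Type*} [Fintype ι] (ψ : ι → ℂ) : ℝ := ∑ i, ‖ψ i‖ ^ 2

/-- The density matrix of the normalized post-measurement Choi state. -/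
def postChoi {n k m : ℕ} (Ξ : Matrix (Bits n) (Bits k) ℂ) (M : Fin m → QubitUnitary n) :
    Matrix (Bits n × Bits k) (Bits n × Bits k) ℂ :=
  ((sqNorm (projectedChoi Ξ M))⁻¹ : ℂ) •
    Matrix.vecMulVec (projectedChoi Ξ M) (star (projectedChoi Ξ M))

/-! ### Entropy and mutual information -/

/-- The reduced density matrix on the first factor. -/
def reduceFst {α β : Type*} [Fintype β] (ρ : Matrix (α × β) (α × β) ℂ) : Matrix α α ℂ :=
  Matrix.of fun x x' => ∑ y, ρ (x, y) (x', y)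

/-- The reduced density matrix on the second factor. -/
def reduceSnd {α β : Type*} [Fintype α] (ρ : Matrix (α × β) (α × β) ℂ) : Matrix β β ℂ :=
  Matrix.of fun y y' => ∑ x, ρ (x, y) (x, y')

/-- The von Neumann entropy `-Tr (ρ log₂ ρ)`, in bits. -/
def vonNeumannEntropy {α : Type*} [Fintype α] [DecidableEq α] (ρ : Matrix α α ℂ) : ℝ :=
  (cfc (fun x : ℝ => -(x * Real.logb 2 x)) ρ).trace.re

/-- The mutual information `I(A, R) = S_A + S_R - S_{AR}`. -/
def mutualInformation {α β : Type*} [Fintype α] [DecidableEq α] [Fintype β] [DecidableEq β]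
    (ρ : Matrix (α × β) (α × β) ℂ) : ℝ :=
  vonNeumannEntropy (reduceFst ρ) + vonNeumannEntropy (reduceSnd ρ) - vonNeumannEntropy ρ

end

end MonitoredCodes

open MonitoredCodes

/-!
The projectors onto the code space and onto the post-measurement states are the averages `Π_S` and
`Π_M` of the groups `S` and `ℳ` (`groupAverage`, `encoding_mul_conjTranspose`,
`measurementProj_eq_groupAverage`), and two Pauli operators either commute or anticommute, with a
sign that is a character in each argument (`commSign`).

Absence of measured logical operators and correctability of logical operators are dual statements
about the commutation pairing `S × ℳ → {1, -1}`. If `ℓ` commutes with `ℳ ⊓ 𝒞(S)`, summing the sign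
`⟨u, ℓ * s⟩` over `u ∈ ℳ` and `s ∈ S` in both orders shows that some `ℓ * s` commutes with `ℳ`
(`exists_mul_commute_of_commute_inf`). Conversely, an element `u` of `ℳ ⊓ ℒ` commutes with every
`ℓ` that has a representative commuting with `ℳ`, since it commutes with `S`; so it commutes with
all of `ℒ`, and lies in `S` up to a phase by the double centralizer theorem, which is the
same character sum with the whole Pauli group in place of `ℳ`. The phase is `1` because the outcomes are possible.

For the entropies, the post-measurement Choi state is pure, so `S_A = S_R` and `S_AR = 0`, and
`I(A, R) = 2 S_R` equals `2 k` exactly if the reference is maximally mixed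
(`mutualInformation_pure_eq_iff`), that is, if `Ξ† Π_M Ξ` is a scalar
(`mutualInformation_postChoi_eq_iff`). For Pauli operators `u`, the operator `Π_S u Π_S` vanishes
unless `u ∈ ℒ`, and is `Π_S` if `u ∈ S`; hence `Ξ† Π_M Ξ` is a scalar if `ℳ ⊓ ℒ ≤ S`. Conversely,
if it is a scalar then `Π_S Π_M Π_S` is a nonzero multiple of `Π_S`; it is fixed by every
`u ∈ ℳ ⊓ ℒ`, so `u Π_S = Π_S`, which forces `u ∈ S` because all Pauli operators but the scalars are
traceless (`mem_of_mul_groupAverage_eq`).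
-/

namespace MonitoredCodes

/-! ### Entropy of pure bipartite states -/

section Entropy

variable {α β : Type*} [Fintype α] [DecidableEq α] [Fintype β] [DecidableEq β]

open Polynomial in
theorem exists_polynomial_eqOn {s : Set ℝ} (hs : s.Finite) (f : ℝ → ℝ) :
    ∃ p : ℝ[X], ∀ x ∈ s, f x = p.eval x :=
  ⟨Lagrange.interpolate hs.toFinset id f, fun _ hx =>
    (Lagrange.eval_interpolate_at_node (v := id) f Function.injective_id.injOn
      (hs.mem_toFinset.2 hx)).symm⟩

open Polynomial in
theorem mul_aeval_mul_comm (q : ℝ[X]) (A : Matrix α β ℂ) (B : Matrix β α ℂ) :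
    aeval (A * B) q * A = A * aeval (B * A) q := by
  have hpow (j : ℕ) : (A * B) ^ j * A = A * (B * A) ^ j := by
    induction j with
    | zero => simp
    | succ j ih => rw [pow_succ', pow_succ', Matrix.mul_assoc, ih]; simp only [Matrix.mul_assoc]
  simp only [aeval_eq_sum_range, Matrix.sum_mul, Matrix.mul_sum, Matrix.smul_mul,
    Matrix.mul_smul, hpow]

open Polynomial in
/-- On matrices every function of the functional calculus is a polynomial, so the isospectrality
of `A * B` and `B * A` away from `0` comes down to the cyclicity of the trace. -/
theorem trace_cfc_mul_comm (f : ℝ → ℝ) (hf : f 0 = 0) (A : Matrix α β ℂ) (B : Matrix β α ℂ)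
    (hAB : IsSelfAdjoint (A * B)) (hBA : IsSelfAdjoint (B * A)) :
    (cfc f (A * B)).trace = (cfc f (B * A)).trace := by
  obtain ⟨p, hp⟩ := exists_polynomial_eqOn
    (((A * B).finite_real_spectrum.union (B * A).finite_real_spectrum).union
      (Set.finite_singleton (0 : ℝ))) f
  have h0 : p.eval 0 = 0 := by rw [← hp 0 (by simp), hf]
  obtain ⟨q, rfl⟩ : X ∣ p := X_dvd_iff.2 (by rwa [coeff_zero_eq_eval_zero])
  rw [cfc_congr (g := (X * q).eval) fun x hx => hp x (Or.inl (Or.inl hx)),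
    cfc_congr (a := B * A) (g := (X * q).eval) fun x hx => hp x (Or.inl (Or.inr hx)),
    cfc_polynomial _ _ hAB, cfc_polynomial _ _ hBA, map_mul, map_mul, aeval_X, aeval_X,
    Matrix.mul_assoc, Matrix.trace_mul_comm, Matrix.mul_assoc B, mul_aeval_mul_comm,
    Matrix.mul_assoc]

open Polynomial in
theorem trace_cfc_transpose (f : ℝ → ℝ) (A : Matrix α α ℂ) (hA : A.IsHermitian) :
    (cfc f A.transpose).trace = (cfc f A).trace := by
  obtain ⟨p, hp⟩ := exists_polynomial_eqOn
    (A.finite_real_spectrum.union A.transpose.finite_real_spectrum) f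
  rw [cfc_congr (a := A) (g := p.eval) fun x hx => hp x (Or.inl hx),
    cfc_congr (a := A.transpose) (g := p.eval) fun x hx => hp x (Or.inr hx),
    cfc_polynomial _ _ hA.isSelfAdjoint, cfc_polynomial _ _ hA.transpose.isSelfAdjoint]
  simp [aeval_eq_sum_range, Matrix.trace_sum, Matrix.trace_smul, ← Matrix.transpose_pow]

/-- A pure state has no entropy, and its two reduced states have the same nonzero spectrum. -/
theorem mutualInformation_pure (ψ : α × β → ℂ) (hψ : sqNorm ψ = 1) :
    mutualInformation (Matrix.vecMulVec ψ (star ψ)) =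
      2 * vonNeumannEntropy (reduceSnd (Matrix.vecMulVec ψ (star ψ))) := by
  have hAR : vonNeumannEntropy (Matrix.vecMulVec ψ (star ψ)) = 0 := by
    have hidem : IsIdempotentElem (Matrix.vecMulVec ψ (star ψ)) := by
      have h1 : star ψ ⬝ᵥ ψ = 1 := by
        rw [← Complex.ofReal_one, ← hψ]
        simp [dotProduct, sqNorm, Complex.conj_mul']
      rw [IsIdempotentElem, Matrix.vecMulVec_mul_vecMulVec, h1, one_smul]
    rw [vonNeumannEntropy, cfc_congr (g := fun _ => 0), cfc_const_zero]
    · simp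
    · intro x hx
      rcases hidem.spectrum_subset ℝ hx with rfl | rfl <;> simp
  set W : Matrix α β ℂ := Matrix.of fun x y => ψ (x, y) with hW
  have hA : reduceFst (Matrix.vecMulVec ψ (star ψ)) = W * W.conjTranspose := by
    ext x x'
    simp [reduceFst, Matrix.vecMulVec_apply, Matrix.mul_apply, hW]
  have hR : reduceSnd (Matrix.vecMulVec ψ (star ψ)) = (W.conjTranspose * W).transpose := by
    ext y y'
    simp [reduceSnd, Matrix.vecMulVec_apply, Matrix.mul_apply, hW, mul_comm]
  rw [mutualInformation, hAR, hA, hR, vonNeumannEntropy, vonNeumannEntropy,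
    trace_cfc_transpose _ _ (Matrix.isHermitian_conjTranspose_mul_self W),
    trace_cfc_mul_comm _ (by simp) _ _ (Matrix.isHermitian_mul_conjTranspose_self W)
      (Matrix.isHermitian_conjTranspose_mul_self W)]
  ring

theorem trace_cfc_eq_sum (f : ℝ → ℝ) {A : Matrix α α ℂ} (hA : A.IsHermitian) :
    (cfc f A).trace = ∑ i, (f (hA.eigenvalues i) : ℂ) := by
  rw [hA.cfc_eq, Matrix.IsHermitian.cfc, Unitary.conjStarAlgAut_apply, Matrix.trace_mul_comm,
    ← mul_assoc]
  simp [Matrix.trace]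

open scoped ComplexOrder in
/-- The entropy of a density matrix is maximal exactly for the maximally mixed state, by the
equality case of Jensen's inequality for `-x log x`. -/
theorem vonNeumannEntropy_eq_logb_card_iff [Nonempty α] {ρ : Matrix α α ℂ} (hρ : ρ.PosSemidef)
    (htr : ρ.trace = 1) :
    vonNeumannEntropy ρ = Real.logb 2 (Fintype.card α) ↔
      ρ = ((Fintype.card α : ℂ)⁻¹) • 1 := by
  have hd : (Fintype.card α : ℝ) ≠ 0 := by simp
  constructor
  · intro h
    have hsum : ∑ i, hρ.1.eigenvalues i = 1 := by
      have := hρ.1.trace_eq_sum_eigenvalues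
      rw [htr] at this
      exact (Complex.ofReal_injective (by simpa using this)).symm
    have hent : ∑ i, Real.negMulLog (hρ.1.eigenvalues i) = Real.log (Fintype.card α) := by
      rw [vonNeumannEntropy, trace_cfc_eq_sum _ hρ.1] at h
      have h2 : Real.log 2 ≠ 0 := (Real.log_pos one_lt_two).ne'
      have : (∑ i, Real.negMulLog (hρ.1.eigenvalues i)) / Real.log 2
          = Real.log (Fintype.card α) / Real.log 2 := by
        rw [Real.log_div_log, ← h, Finset.sum_div, Complex.re_sum]
        refine Finset.sum_congr rfl fun i _ => ?_
        rw [Complex.ofReal_re, Real.negMulLog, Real.logb]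
        ring
      field_simp at this
      exact this
    have heq := (Real.strictConcaveOn_negMulLog.map_sum_eq_iff (t := Finset.univ)
      (w := fun _ : α => (Fintype.card α : ℝ)⁻¹) (p := hρ.1.eigenvalues)
      (fun _ _ => by positivity) (by simp)
      (fun i _ => hρ.eigenvalues_nonneg i)).1 (by
        simp only [smul_eq_mul, ← Finset.mul_sum, hsum, hent]
        simp [Real.negMulLog])
    simp only [smul_eq_mul, ← Finset.mul_sum, hsum, mul_one, Finset.mem_univ, true_imp_iff] at heq
    conv_lhs => rw [hρ.1.spectral_theorem]
    have hdiag : Matrix.diagonal ((RCLike.ofReal : ℝ → ℂ) ∘ hρ.1.eigenvalues)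
        = ((Fintype.card α : ℂ)⁻¹) • 1 := by
      rw [Matrix.smul_one_eq_diagonal]
      congr 1
      ext i
      simp [heq i]
    rw [hdiag, map_smul, map_one]
  · intro h
    have halg : ρ = algebraMap ℝ (Matrix α α ℂ) (Fintype.card α : ℝ)⁻¹ := by
      rw [h, Matrix.algebraMap_eq_diagonal, Matrix.smul_one_eq_diagonal]
      simp [Pi.algebraMap_def]
    rw [vonNeumannEntropy, halg, cfc_algebraMap, Matrix.algebraMap_eq_diagonal,
      Matrix.trace_diagonal]
    simp

open scoped ComplexOrder in
/-- The mutual information of a normalized pure state is maximal exactly if its coefficient matrix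
is a multiple of an isometry. -/
theorem mutualInformation_pure_eq_iff [Nonempty β] (ψ : α × β → ℂ) (hψ : sqNorm ψ = 1)
    (W : Matrix α β ℂ) (hW : ∀ x y, W x y = ψ (x, y)) :
    mutualInformation (Matrix.vecMulVec ψ (star ψ)) = 2 * Real.logb 2 (Fintype.card β) ↔
      ∃ c : ℂ, W.conjTranspose * W = c • 1 := by
  have hR : reduceSnd (Matrix.vecMulVec ψ (star ψ)) = (W.conjTranspose * W).transpose := by
    ext y y'
    simp [reduceSnd, Matrix.vecMulVec_apply, Matrix.mul_apply, hW, mul_comm]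
  have htr : (W.conjTranspose * W).transpose.trace = 1 := by
    rw [Matrix.trace_transpose, ← Complex.ofReal_one, ← hψ, sqNorm, Fintype.sum_prod_type_right]
    simp [Matrix.trace, Matrix.mul_apply, hW, Complex.conj_mul']
  rw [mutualInformation_pure ψ hψ, mul_right_inj' two_ne_zero, hR,
    vonNeumannEntropy_eq_logb_card_iff
      (Matrix.posSemidef_conjTranspose_mul_self W).transpose htr]
  constructor
  · intro h
    exact ⟨_, by rw [← Matrix.transpose_transpose (W.conjTranspose * W), h, Matrix.transpose_smul,
      Matrix.transpose_one]⟩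
  · rintro ⟨c, hc⟩
    rw [hc, Matrix.transpose_smul, Matrix.transpose_one] at htr ⊢
    rw [Matrix.trace_smul, Matrix.trace_one, smul_eq_mul] at htr
    rw [eq_inv_of_mul_eq_one_left htr]

end Entropy

/-! ### Commutation in the Pauli group -/

section Pauli

variable {n : ℕ}

theorem singlePaulis_commute_or_anticommute {σ τ : Matrix (Fin 2) (Fin 2) ℂ}
    (hσ : σ ∈ singlePaulis) (hτ : τ ∈ singlePaulis) :
    ∃ c : ℤˣ, σ * τ = ((c : ℤ) : ℂ) • (τ * σ) := by
  rcases hσ with rfl | rfl | rfl | rfl <;> rcases hτ with rfl | rfl | rfl | rfl <;>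
  first
  | (refine ⟨1, ?_⟩; simp; done)
  | (refine ⟨-1, ?_⟩
     ext i j; fin_cases i <;> fin_cases j <;> simp [sigmaX, sigmaY, sigmaZ])

theorem exists_singlePaulis_anticommute {σ : Matrix (Fin 2) (Fin 2) ℂ} (hσ : σ ∈ singlePaulis)
    (h1 : σ ≠ 1) : ∃ τ ∈ singlePaulis, σ * τ = (-1 : ℂ) • (τ * σ) := by
  rcases hσ with rfl | rfl | rfl | rfl
  · exact absurd rfl h1
  · exact ⟨sigmaZ, by simp [singlePaulis], by
      ext i j; fin_cases i <;> fin_cases j <;> simp [sigmaX, sigmaZ]⟩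
  · exact ⟨sigmaZ, by simp [singlePaulis], by
      ext i j; fin_cases i <;> fin_cases j <;> simp [sigmaY, sigmaZ]⟩
  · exact ⟨sigmaX, by simp [singlePaulis], by
      ext i j; fin_cases i <;> fin_cases j <;> simp [sigmaX, sigmaZ]⟩

theorem singlePaulis_mul_self {σ : Matrix (Fin 2) (Fin 2) ℂ} (hσ : σ ∈ singlePaulis) :
    σ * σ = 1 := by
  rcases hσ with rfl | rfl | rfl | rfl
  · simp
  all_goals
    ext i j
    fin_cases i <;> fin_cases j <;> simp [sigmaX, sigmaY, sigmaZ]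

theorem tensorOp_mem_unitaryGroup {σ : Fin n → Matrix (Fin 2) (Fin 2) ℂ}
    (hσ : ∀ j, σ j ∈ singlePaulis) : tensorOp σ ∈ Matrix.unitaryGroup (Bits n) ℂ := by
  rw [Matrix.mem_unitaryGroup_iff, tensorOp_star, tensorOp_mul, ← tensorOp_one]
  congr
  ext1 j
  rw [singlePaulis_star (hσ j), singlePaulis_mul_self (hσ j)]

instance finite_pauliGroup : Finite (pauliGroup n) := by
  have hfin : (singlePaulis : Set (Matrix (Fin 2) (Fin 2) ℂ)).Finite := by
    simp [singlePaulis]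
  have := hfin.to_subtype
  let F : Fin 4 × (Fin n → singlePaulis) → Op n :=
    fun p => Complex.I ^ (p.1 : ℕ) • tensorOp fun j => (p.2 j : Matrix (Fin 2) (Fin 2) ℂ)
  have hmem (U : pauliGroup n) : ((U : QubitUnitary n) : Op n) ∈ Set.range F := by
    obtain ⟨U, c, σ, hσ, hU⟩ := U
    refine ⟨(⟨c % 4, Nat.mod_lt _ (by norm_num)⟩, fun j => ⟨σ j, hσ j⟩), ?_⟩
    simp only [F, hU]
    rw [Complex.I_pow_eq_pow_mod c]
  have := (Set.finite_range F).to_subtype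
  refine Finite.of_injective (fun U => (⟨_, hmem U⟩ : Set.range F)) fun U V h => ?_
  exact Subtype.ext (Subtype.ext (by simpa using h))

theorem finite_of_le_pauliGroup {H : Subgroup (QubitUnitary n)} (hH : H ≤ pauliGroup n) :
    Finite H :=
  Finite.of_injective _ (Subgroup.inclusion_injective hH)

theorem commute_or_anticommute {U V : QubitUnitary n} (hU : U ∈ pauliGroup n)
    (hV : V ∈ pauliGroup n) : U * V = V * U ∨ U * V = -(V * U) := by
  obtain ⟨a, σ, hσ, hU⟩ := hU
  obtain ⟨b, τ, hτ, hV⟩ := hV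
  choose c hc using fun j => singlePaulis_commute_or_anticommute (hσ j) (hτ j)
  have h : (U * V : Op n) = (((∏ j, c j : ℤˣ) : ℤ) : ℂ) • (V * U : Op n) := by
    rw [hU, hV, Matrix.smul_mul, Matrix.mul_smul, Matrix.smul_mul, Matrix.mul_smul, tensorOp_mul,
      tensorOp_mul, funext hc, tensorOp_smul, Units.coe_prod]
    push_cast
    simp only [smul_smul]
    congr 1
    ring
  rcases Int.units_eq_one_or (∏ j, c j) with h1 | h1 <;> rw [h1] at h
  · left; exact Subtype.ext (by simpa using h)
  · right; exact Subtype.ext (h.trans (by simp; rfl))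

/-- The symplectic form of the Pauli group is nondegenerate modulo phases. -/
theorem scalar_or_exists_anticommute {U : QubitUnitary n} (hU : U ∈ pauliGroup n) :
    (∃ c : ℂ, (U : Op n) = c • (1 : Op n)) ∨ ∃ V ∈ pauliGroup n, U * V = -(V * U) := by
  obtain ⟨a, σ, hσ, hU⟩ := hU
  by_cases h : ∀ j, σ j = 1
  · left
    exact ⟨_, by rw [hU, funext h, tensorOp_one]⟩
  · right
    push Not at h
    obtain ⟨j, hj⟩ := h
    obtain ⟨τ, hτ, hanti⟩ := exists_singlePaulis_anticommute (hσ j) hj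
    have hmem (i) :
        Function.update (1 : Fin n → Matrix (Fin 2) (Fin 2) ℂ) j τ i ∈ singlePaulis := by
      by_cases hi : i = j
      · subst hi; simpa
      · simp [hi, singlePaulis]
    refine ⟨⟨_, tensorOp_mem_unitaryGroup hmem⟩, ⟨0, _, hmem, by simp⟩, ?_⟩
    apply Subtype.ext
    have hprod :
        (fun i => σ i * Function.update (1 : Fin n → Matrix (Fin 2) (Fin 2) ℂ) j τ i) = fun i =>
        (Function.update (1 : Fin n → ℂ) j (-1) i) •
          (Function.update (1 : Fin n → Matrix (Fin 2) (Fin 2) ℂ) j τ i * σ i) := by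
      ext1 i
      by_cases hi : i = j
      · subst hi; simpa using hanti
      · simp [hi]
    have : (U : Op n) * tensorOp (Function.update (1 : Fin n → Matrix (Fin 2) (Fin 2) ℂ) j τ)
        = -(tensorOp (Function.update (1 : Fin n → Matrix (Fin 2) (Fin 2) ℂ) j τ) * (U : Op n)) := by
      rw [hU, Matrix.smul_mul, Matrix.mul_smul, tensorOp_mul, tensorOp_mul, hprod, tensorOp_smul,
        Finset.prod_update_of_mem (Finset.mem_univ j)]
      simp
    exact this

theorem trace_eq_zero_of_anticommute {U V : QubitUnitary n} (h : U * V = -(V * U)) :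
    (U : Op n).trace = 0 := by
  have h1 : (U : Op n) = -((V : Op n) * U * (V⁻¹ : QubitUnitary n)) := by
    have : U = -(V * U * V⁻¹) := by
      rw [← neg_mul, ← h, mul_inv_cancel_right]
    exact congrArg Subtype.val this
  have h2 := congrArg Matrix.trace h1
  rw [Matrix.trace_neg, Matrix.trace_mul_comm, ← Matrix.mul_assoc, ← Submonoid.coe_mul,
    inv_mul_cancel, Submonoid.coe_one, Matrix.one_mul] at h2
  exact self_eq_neg.1 h2

theorem ne_neg_self (U : QubitUnitary n) : U ≠ -U := by
  intro h
  have h1 : (U : Op n) = -(U : Op n) := congrArg Subtype.val h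
  have h2 : (U : Op n) = 0 := by
    ext x y
    exact self_eq_neg.1 (congrFun (congrFun h1 x) y)
  have h3 : (U : Op n) * star (U : Op n) = 1 := Matrix.mem_unitaryGroup_iff.1 U.2
  rw [h2, Matrix.zero_mul] at h3
  exact zero_ne_one h3

open Classical in
/-- The commutation sign of two Pauli operators: `1` if they commute and `-1` if not. -/
noncomputable def commSign (U V : QubitUnitary n) : ℂ := if U * V = V * U then 1 else -1

theorem commSign_of_commute {U V : QubitUnitary n} (h : U * V = V * U) : commSign U V = 1 :=
  if_pos h

theorem commSign_of_anticommute {U V : QubitUnitary n} (h : U * V = -(V * U)) :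
    commSign U V = -1 :=
  if_neg (h ▸ (ne_neg_self _).symm)

theorem commSign_comm (U V : QubitUnitary n) : commSign U V = commSign V U := by
  simp only [commSign, eq_comm]

theorem commSign_mul {U V W : QubitUnitary n} (hU : U ∈ pauliGroup n) (hV : V ∈ pauliGroup n)
    (hW : W ∈ pauliGroup n) : commSign U (V * W) = commSign U V * commSign U W := by
  rcases commute_or_anticommute hU hV with h1 | h1 <;>
  rcases commute_or_anticommute hU hW with h2 | h2
  · rw [commSign_of_commute h1, commSign_of_commute h2, commSign_of_commute, mul_one]
    rw [← mul_assoc, h1, mul_assoc, h2, mul_assoc]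
  · rw [commSign_of_commute h1, commSign_of_anticommute h2, commSign_of_anticommute, one_mul]
    rw [← mul_assoc, h1, mul_assoc, h2, mul_neg, mul_assoc]
  · rw [commSign_of_anticommute h1, commSign_of_commute h2, commSign_of_anticommute, mul_one]
    rw [← mul_assoc, h1, neg_mul, mul_assoc, h2, mul_assoc]
  · rw [commSign_of_anticommute h1, commSign_of_anticommute h2, commSign_of_commute,
      neg_one_mul, neg_neg]
    rw [← mul_assoc, h1, neg_mul, mul_assoc, h2, mul_neg, neg_neg, mul_assoc]

/-- A commutation character that is not trivial on a group of Pauli operators sums to zero. -/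
theorem sum_commSign_eq_zero {H : Subgroup (QubitUnitary n)} [Fintype H] (hH : H ≤ pauliGroup n)
    {U : QubitUnitary n} (hU : U ∈ pauliGroup n) (h : ∃ V ∈ H, U * V = -(V * U)) :
    ∑ V : H, commSign U V = 0 := by
  let f : H →* ℂ :=
    { toFun := fun V => commSign U V
      map_one' := commSign_of_commute (by simp)
      map_mul' := fun V W => commSign_mul hU (hH V.2) (hH W.2) }
  refine sum_hom_units_eq_zero f fun hf => ?_
  obtain ⟨V, hV, hUV⟩ := h
  have := DFunLike.congr_fun hf ⟨V, hV⟩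
  have h1 : commSign U V = 1 := this
  rw [commSign_of_anticommute hUV] at h1
  norm_num at h1

theorem sum_commSign_of_commute {H : Subgroup (QubitUnitary n)} [Fintype H]
    {U : QubitUnitary n} (h : ∀ V ∈ H, U * V = V * U) :
    ∑ V : H, commSign U V = Fintype.card H := by
  simp [fun V : H => commSign_of_commute (h V V.2)]

/-- Write `⟨u, v⟩` for the commutation sign. If no `s` in `S` corrected the commutation of `ℓ`
with `K`, the double character sum `∑ u ∈ K, ∑ s ∈ S, ⟨u, ℓ * s⟩` would vanish; but only the `u`
that commute with `S` contribute to it, each with `⟨u, ℓ⟩ = 1`. -/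
theorem exists_mul_commute_of_commute_inf {S K : Subgroup (QubitUnitary n)}
    (hS : S ≤ pauliGroup n) (hK : K ≤ pauliGroup n) {ℓ : QubitUnitary n} (hℓ : ℓ ∈ pauliGroup n)
    (h : ∀ u ∈ K ⊓ pauliCentralizer S, ℓ * u = u * ℓ) :
    ∃ s ∈ S, ∀ u ∈ K, ℓ * s * u = u * (ℓ * s) := by
  have := finite_of_le_pauliGroup hS
  have := Fintype.ofFinite S
  have := finite_of_le_pauliGroup hK
  have := Fintype.ofFinite K
  classical
  by_contra! hcon
  have h0 : ∑ u : K, ∑ s : S, commSign (u : QubitUnitary n) (ℓ * s) = 0 := by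
    rw [Finset.sum_comm]
    refine Finset.sum_eq_zero fun s _ => ?_
    simp only [commSign_comm _ (ℓ * (s : QubitUnitary n))]
    have hls := mul_mem hℓ (hS s.2)
    obtain ⟨u, hu, hne⟩ := hcon s s.2
    exact sum_commSign_eq_zero hK hls
      ⟨u, hu, (commute_or_anticommute hls (hK hu)).resolve_left hne⟩
  have h1 : 0 < (∑ u : K, ∑ s : S, commSign (u : QubitUnitary n) (ℓ * s)).re := by
    have hterm (u : K) :
        ∑ s : S, commSign (u : QubitUnitary n) (ℓ * s) =
          if (u : QubitUnitary n) ∈ pauliCentralizer S then (Fintype.card S : ℂ) else 0 := by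
      simp only [fun s : S => commSign_mul (hK u.2) hℓ (hS s.2), ← Finset.mul_sum]
      split_ifs with hu
      · rw [sum_commSign_of_commute fun s hs => (Subgroup.mem_centralizer_iff.1 hu.2 s hs).symm,
          commSign_of_commute (h u ⟨u.2, hu⟩).symm, one_mul]
      · rw [sum_commSign_eq_zero hS (hK u.2), mul_zero]
        by_contra! hanti
        exact hu ⟨hK u.2, Subgroup.mem_centralizer_iff.2 fun s hs =>
          ((commute_or_anticommute (hK u.2) (hS hs)).resolve_right (hanti s hs)).symm⟩
    rw [Complex.re_sum]
    refine Finset.sum_pos' (fun u _ => ?_) ⟨1, Finset.mem_univ _, ?_⟩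
    · rw [hterm]
      split_ifs <;> simp
    · rw [hterm, if_pos (show ((1 : K) : QubitUnitary n) ∈ _ from one_mem _), Complex.natCast_re]
      exact_mod_cast Fintype.card_pos
  rw [h0] at h1
  simp at h1

/-- The double centralizer theorem of the Pauli group: whatever commutes with the logical
operators of `S` is, up to a phase, in `S`. -/
theorem exists_mul_eq_smul_one_of_commute_pauliCentralizer {S : Subgroup (QubitUnitary n)}
    (hS : S ≤ pauliGroup n) {U : QubitUnitary n} (hU : U ∈ pauliGroup n)
    (hUS : ∀ V ∈ pauliCentralizer S, U * V = V * U) :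
    ∃ s ∈ S, ∃ c : ℂ, ((U * s : QubitUnitary n) : Op n) = c • (1 : Op n) := by
  obtain ⟨s, hs, h⟩ := exists_mul_commute_of_commute_inf hS le_rfl hU fun V hV => hUS V hV.2
  refine ⟨s, hs, (scalar_or_exists_anticommute (mul_mem hU (hS hs))).resolve_right ?_⟩
  rintro ⟨V, hV, hanti⟩
  rw [h V hV] at hanti
  exact ne_neg_self _ hanti

end Pauli

/-! ### Group averages as projectors -/

section GroupAverage

variable {n : ℕ}

/-- The average `|H|⁻¹ ∑ u ∈ H, u` of a finite group of unitary operators, which is the orthogonal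
projector onto the vectors fixed by `H`. -/
noncomputable def groupAverage (H : Subgroup (QubitUnitary n)) [Fintype H] : Op n :=
  (Fintype.card H : ℂ)⁻¹ • ∑ u : H, ((u : QubitUnitary n) : Op n)

variable {H : Subgroup (QubitUnitary n)} [Fintype H]

theorem groupAverage_eq_of_forall_mul_eq {ι : Type*} {A : Matrix (Bits n) ι ℂ}
    (h : ∀ u ∈ H, (u : Op n) * A = A) : groupAverage H * A = A := by
  have hc : (Fintype.card H : ℂ) ≠ 0 := by simp
  rw [groupAverage, Matrix.smul_mul, Matrix.sum_mul,
    Finset.sum_congr rfl fun (u : H) _ => h u u.2]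
  simp only [Finset.sum_const, Finset.card_univ, ← Nat.cast_smul_eq_nsmul ℂ, smul_smul]
  rw [inv_mul_cancel₀ hc, one_smul]

theorem mul_groupAverage {u : QubitUnitary n} (hu : u ∈ H) :
    (u : Op n) * groupAverage H = groupAverage H := by
  rw [groupAverage, Matrix.mul_smul, Matrix.mul_sum]
  congr 1
  exact Fintype.sum_equiv (Equiv.mulLeft (⟨u, hu⟩ : H)) _ _ fun v => rfl

theorem groupAverage_mul {u : QubitUnitary n} (hu : u ∈ H) :
    groupAverage H * (u : Op n) = groupAverage H := by
  rw [groupAverage, Matrix.smul_mul, Matrix.sum_mul]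
  congr 1
  exact Fintype.sum_equiv (Equiv.mulRight (⟨u, hu⟩ : H)) _ _ fun v => rfl

theorem groupAverage_mul_self : groupAverage H * groupAverage H = groupAverage H :=
  groupAverage_eq_of_forall_mul_eq fun _ => mul_groupAverage

theorem conjTranspose_groupAverage : (groupAverage H).conjTranspose = groupAverage H := by
  rw [groupAverage, Matrix.conjTranspose_smul, Matrix.conjTranspose_sum]
  congr 1
  · simp
  · exact Fintype.sum_equiv (Equiv.inv H) _ _ fun v => rfl

open scoped ComplexOrder in
theorem groupAverage_mul_eq_zero {ι : Type*} [Fintype ι] {A : Matrix (Bits n) ι ℂ}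
    (h : A.conjTranspose * groupAverage H * A = 0) : groupAverage H * A = 0 := by
  rw [← Matrix.conjTranspose_mul_self_eq_zero, Matrix.conjTranspose_mul,
    conjTranspose_groupAverage, Matrix.mul_assoc, ← Matrix.mul_assoc _ _ A,
    groupAverage_mul_self, ← Matrix.mul_assoc, h]

theorem groupAverage_commute {u : QubitUnitary n} (hu : u ∈ pauliCentralizer H) :
    (u : Op n) * groupAverage H = groupAverage H * (u : Op n) := by
  rw [groupAverage, Matrix.mul_smul, Matrix.smul_mul, Matrix.sum_mul, Matrix.mul_sum]
  congr 1
  refine Finset.sum_congr rfl fun v _ => ?_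
  exact congrArg Subtype.val (Subgroup.mem_centralizer_iff.1 hu.2 v v.2).symm

theorem groupAverage_mul_mul_groupAverage_eq_zero (hH : H ≤ pauliGroup n) {u : QubitUnitary n}
    (hu : u ∈ pauliGroup n) (hu' : u ∉ pauliCentralizer H) :
    groupAverage H * (u : Op n) * groupAverage H = 0 := by
  obtain ⟨s, hs, hanti⟩ : ∃ s ∈ H, s * u = -(u * s) := by
    by_contra! h
    exact hu' ⟨hu, Subgroup.mem_centralizer_iff.2 fun s hs =>
      (commute_or_anticommute (hH hs) hu).resolve_right (h s hs)⟩
  have h1 : (s : Op n) * u = -((u : Op n) * s) := congrArg Subtype.val hanti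
  have h2 : groupAverage H * (u : Op n) * groupAverage H
      = -(groupAverage H * (u : Op n) * groupAverage H) := by
    conv_lhs => rw [← groupAverage_mul hs, Matrix.mul_assoc (groupAverage H), h1]
    rw [groupAverage_mul hs, Matrix.mul_neg, Matrix.neg_mul, ← Matrix.mul_assoc,
      Matrix.mul_assoc _ (s : Op n), mul_groupAverage hs]
  ext x y
  exact self_eq_neg.1 (congrFun (congrFun h2 x) y)

open scoped ComplexOrder in
/-- A stabilizer group contains every Pauli operator that fixes its code space. If no `u * s` with
`s ∈ H` were a scalar, all of them would be traceless, and so would be the nonzero projector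
`u * groupAverage H`; and a scalar `u * s` is `1`, as it fixes the code space. -/
theorem mem_of_mul_groupAverage_eq (hH : H ≤ pauliGroup n) {u : QubitUnitary n}
    (hu : u ∈ pauliGroup n) (h0 : groupAverage H ≠ 0)
    (h : (u : Op n) * groupAverage H = groupAverage H) : u ∈ H := by
  obtain ⟨s, hs, c, hc⟩ : ∃ s ∈ H, ∃ c : ℂ, ((u * s : QubitUnitary n) : Op n) = c • (1 : Op n) := by
    by_contra! hcon
    have htr : (groupAverage H).trace = 0 := by
      rw [← h, groupAverage, Matrix.mul_smul, Matrix.mul_sum, Matrix.trace_smul, Matrix.trace_sum,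
        Finset.sum_eq_zero, smul_zero]
      intro s _
      have hus := mul_mem hu (hH s.2)
      obtain ⟨V, -, hV⟩ := (scalar_or_exists_anticommute hus).resolve_left
        fun ⟨c, hc⟩ => hcon s s.2 c hc
      exact trace_eq_zero_of_anticommute hV
    rw [← groupAverage_mul_self] at htr
    nth_rw 1 [← conjTranspose_groupAverage] at htr
    exact h0 (Matrix.trace_conjTranspose_mul_self_eq_zero_iff.1 htr)
  have h1 : c • groupAverage H = groupAverage H := by
    conv_rhs => rw [← h, ← mul_groupAverage hs, ← Matrix.mul_assoc]
    rw [← Submonoid.coe_mul, hc, Matrix.smul_mul, Matrix.one_mul]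
  have hc1 : c = 1 := by
    have : (c - 1) • groupAverage H = 0 := by rw [sub_smul, h1, one_smul, sub_self]
    exact sub_eq_zero.1 ((smul_eq_zero.1 this).resolve_right h0)
  have hus : u * s = 1 := Subtype.ext (by rw [hc, hc1, one_smul]; rfl)
  rw [eq_inv_of_mul_eq_one_left hus]
  exact inv_mem hs

end GroupAverage

/-! ### The measurement projector -/

section Measurement

variable {n m : ℕ}

theorem mul_list_prod_eq {R : Type*} [Monoid R] {a x : R} (hax : a * x = x) {l : List R}
    (hx : x ∈ l) (hcomm : ∀ y ∈ l, a * y = y * a) : a * l.prod = l.prod := by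
  induction l with
  | nil => simp at hx
  | cons y l ih =>
    rw [List.prod_cons, ← mul_assoc]
    rcases List.mem_cons.1 hx with rfl | hx
    · rw [hax]
    · rw [hcomm y (by simp), mul_assoc, ih hx fun z hz => hcomm z (by simp [hz])]

theorem mul_list_prod_eq_left {R : Type*} [Monoid R] {a : R} {l : List R}
    (h : ∀ y ∈ l, a * y = a) : a * l.prod = a := by
  induction l with
  | nil => simp
  | cons y l ih =>
    rw [List.prod_cons, ← mul_assoc, h y (by simp), ih fun z hz => h z (by simp [hz])]

/-- Both operators are the projector onto the common `+1` eigenspace of the `M j`. -/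
theorem measurementProj_eq_groupAverage {M : Fin m → QubitUnitary n}
    (hcomm : ∀ i j, M i * M j = M j * M i) (hsq : ∀ j, M j * M j = 1)
    [Fintype (measuredGroup M)] : measurementProj M = groupAverage (measuredGroup M) := by
  have hM (j : Fin m) : (M j : Op n) * measurementProj M = measurementProj M := by
    have hsq' : (M j : Op n) * M j = 1 := congrArg Subtype.val (hsq j)
    refine mul_list_prod_eq (x := (1 / 2 : ℂ) • (1 + (M j : Op n))) ?_
      (List.mem_ofFn.2 ⟨j, rfl⟩) fun y hy => ?_
    · rw [Matrix.mul_smul, Matrix.mul_add, Matrix.mul_one, hsq', add_comm]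
    · obtain ⟨i, rfl⟩ := List.mem_ofFn.1 hy
      have hij : (M j : Op n) * M i = M i * M j := congrArg Subtype.val (hcomm j i)
      rw [Matrix.mul_smul, Matrix.smul_mul, Matrix.mul_add, Matrix.add_mul, Matrix.mul_one,
        Matrix.one_mul, hij]
  have hleft (u) (hu : u ∈ measuredGroup M) :
      (u : Op n) * measurementProj M = measurementProj M := by
    induction hu using Subgroup.closure_induction with
    | mem u hu => obtain ⟨j, rfl⟩ := hu; exact hM j
    | one => rw [Submonoid.coe_one, Matrix.one_mul]
    | mul u v _ _ hu hv => rw [Submonoid.coe_mul, Matrix.mul_assoc, hv, hu]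
    | inv u _ hu =>
      conv_lhs => rw [← hu, ← Matrix.mul_assoc, ← Submonoid.coe_mul, inv_mul_cancel,
        Submonoid.coe_one, Matrix.one_mul]
  rw [← groupAverage_eq_of_forall_mul_eq hleft]
  refine mul_list_prod_eq_left fun y hy => ?_
  obtain ⟨j, rfl⟩ := List.mem_ofFn.1 hy
  rw [Matrix.mul_smul, Matrix.mul_add, Matrix.mul_one,
    groupAverage_mul (show M j ∈ measuredGroup M from Subgroup.subset_closure ⟨j, rfl⟩),
    ← two_smul ℂ, smul_smul]
  norm_num

end Measurement

/-! ### The post-measurement Choi state -/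

section Encoding

variable {n k : ℕ} {S : Subgroup (QubitUnitary n)} {Ξ : Matrix (Bits n) (Bits k) ℂ}

theorem mul_encoding (hΞ : IsEncodingIsometry S Ξ) {s : QubitUnitary n} (hs : s ∈ S) :
    (s : Op n) * Ξ = Ξ := by
  ext x y
  have hmem : Ξ.mulVecLin (Pi.single y 1) ∈ codeSpace S := hΞ.range_eq ▸ ⟨_, rfl⟩
  have h := congrFun (hmem s hs) x
  rw [Matrix.mulVecLin_apply, Matrix.mulVec_mulVec] at h
  simpa using h

theorem encoding_mul_conjTranspose [Fintype S] (hΞ : IsEncodingIsometry S Ξ) :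
    Ξ * Ξ.conjTranspose = groupAverage S := by
  have h1 : groupAverage S * Ξ = Ξ :=
    groupAverage_eq_of_forall_mul_eq fun _ hs => mul_encoding hΞ hs
  have h2 : Ξ * Ξ.conjTranspose * groupAverage S = groupAverage S := by
    ext x y
    have hmem : (groupAverage S).mulVec (Pi.single y 1) ∈ codeSpace S := fun s hs => by
      rw [Matrix.mulVec_mulVec, mul_groupAverage hs]
    rw [← hΞ.range_eq] at hmem
    obtain ⟨φ, hφ⟩ := hmem
    have h3 : (Ξ * Ξ.conjTranspose).mulVec ((groupAverage S).mulVec (Pi.single y 1))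
        = (groupAverage S).mulVec (Pi.single y 1) := by
      rw [← hφ, Matrix.mulVecLin_apply, Matrix.mulVec_mulVec, Matrix.mul_assoc, hΞ.isometry,
        Matrix.mul_one]
    rw [Matrix.mulVec_mulVec] at h3
    simpa using congrFun h3 x
  have h4 := congrArg Matrix.conjTranspose h1
  rw [Matrix.conjTranspose_mul, conjTranspose_groupAverage] at h4
  rw [← h2, Matrix.mul_assoc, h4]

theorem projectedChoi_apply {m : ℕ} (M : Fin m → QubitUnitary n) (x : Bits n) (y : Bits k) :
    projectedChoi Ξ M (x, y) = (1 / (Real.sqrt 2 : ℂ)) ^ k * (measurementProj M * Ξ) x y := by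
  have hepr (p : Bits k × Bits k) :
      eprPairs k p = if p.1 = p.2 then (1 / (Real.sqrt 2 : ℂ)) ^ k else 0 := by
    rw [eprPairs, Finset.prod_ite_zero]
    simp [funext_iff]
  rw [projectedChoi, choiState, Matrix.mulVec_mulVec, ← Matrix.mul_kronecker_mul, Matrix.one_mul,
    Matrix.mulVec, dotProduct, Fintype.sum_prod_type]
  simp [hepr, Matrix.one_apply, mul_comm]

/-- The post-measurement state of the reference is proportional to the transpose of
`Ξ† * Π * Ξ` with `Π` the measurement projector. -/
theorem mutualInformation_postChoi_eq_iff {m : ℕ} {M : Fin m → QubitUnitary n}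
    (hpossible : sqNorm (projectedChoi Ξ M) ≠ 0)
    (hherm : (measurementProj M).conjTranspose = measurementProj M)
    (hidem : measurementProj M * measurementProj M = measurementProj M) :
    mutualInformation (postChoi Ξ M) = 2 * (k : ℝ) ↔
      ∃ c : ℂ, Ξ.conjTranspose * measurementProj M * Ξ = c • 1 := by
  set N := sqNorm (projectedChoi Ξ M) with hN
  have hN0 : 0 ≤ N := Finset.sum_nonneg fun _ _ => by positivity
  set a : ℝ := (Real.sqrt N)⁻¹ with ha
  have ha2 : a * a = N⁻¹ := by rw [ha, ← mul_inv, Real.mul_self_sqrt hN0]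
  set ψ : Bits n × Bits k → ℂ := (a : ℂ) • projectedChoi Ξ M with hψ
  have hpost : postChoi Ξ M = Matrix.vecMulVec ψ (star ψ) := by
    rw [postChoi, hψ, star_smul, Matrix.smul_vecMulVec, Matrix.vecMulVec_smul, smul_smul, ← hN]
    congr 1
    rw [← Complex.ofReal_inv, ← ha2]
    simp
  have hnorm : sqNorm ψ = 1 := by
    have : sqNorm ψ = a * a * N := by
      simp only [sqNorm, hψ, hN, Pi.smul_apply, smul_eq_mul, norm_mul, mul_pow,
        ← Finset.mul_sum, Complex.norm_real, Real.norm_eq_abs, sq_abs]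
      ring
    rw [this, ha2, inv_mul_cancel₀ hpossible]
  set b : ℂ := (a : ℂ) * (1 / (Real.sqrt 2 : ℂ)) ^ k with hb
  have hb0 : star b * b ≠ 0 := by
    have ha0 : a ≠ 0 := fun h => hpossible (inv_eq_zero.1 (by rw [← ha2, h, mul_zero]))
    have : b ≠ 0 := by simp [hb, ha0]
    exact mul_ne_zero (star_ne_zero.2 this) this
  have hlog : Real.logb 2 (Fintype.card (Bits k)) = k := by
    simp [Real.logb_pow]
  rw [hpost, ← hlog, mutualInformation_pure_eq_iff ψ hnorm (b • (measurementProj M * Ξ))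
    fun x y => by
      rw [hψ, Pi.smul_apply, projectedChoi_apply, Matrix.smul_apply, smul_eq_mul, smul_eq_mul, hb,
        mul_assoc]]
  have hWW : (b • (measurementProj M * Ξ)).conjTranspose * (b • (measurementProj M * Ξ))
      = (star b * b) • (Ξ.conjTranspose * measurementProj M * Ξ) := by
    rw [Matrix.conjTranspose_smul, Matrix.conjTranspose_mul, hherm, Matrix.smul_mul,
      Matrix.mul_smul, smul_smul, Matrix.mul_assoc, ← Matrix.mul_assoc _ _ Ξ, hidem,
      Matrix.mul_assoc]
  rw [hWW]
  constructor
  · rintro ⟨c, hc⟩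
    refine ⟨(star b * b)⁻¹ * c, ?_⟩
    rw [mul_smul, ← hc, inv_smul_smul₀ hb0]
  · rintro ⟨c, hc⟩
    exact ⟨star b * b * c, by rw [hc, smul_smul]⟩

end Encoding

/-! ### The measured operators -/

section Measured

variable {n m : ℕ}

theorem neg_mem_pauliGroup {U : QubitUnitary n} (hU : U ∈ pauliGroup n) : -U ∈ pauliGroup n := by
  obtain ⟨c, σ, hσ, hU⟩ := hU
  refine ⟨c + 2, σ, hσ, ?_⟩
  have : ((-U : QubitUnitary n) : Op n) = -(U : Op n) := rfl
  rw [this, hU, pow_add, Complex.I_sq, mul_neg_one, neg_smul]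

theorem measuredOp_mem_pauliGroup {P : Fin m → QubitUnitary n} (hP : ∀ j, P j ∈ pauliGroup n)
    (outcome : Fin m → ℤˣ) (j : Fin m) : measuredOp P outcome j ∈ pauliGroup n := by
  rw [measuredOp]
  split_ifs
  exacts [hP j, neg_mem_pauliGroup (hP j)]

theorem measuredOp_commute {P : Fin m → QubitUnitary n} (hP : ∀ i j, P i * P j = P j * P i)
    (outcome : Fin m → ℤˣ) (i j : Fin m) :
    measuredOp P outcome i * measuredOp P outcome j =
      measuredOp P outcome j * measuredOp P outcome i := by
  simp only [measuredOp]
  split_ifs <;> simp [hP i j]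

theorem measuredOp_mul_self {P : Fin m → QubitUnitary n} (hP : ∀ j, (P j : Op n).IsHermitian)
    (outcome : Fin m → ℤˣ) (j : Fin m) :
    measuredOp P outcome j * measuredOp P outcome j = 1 := by
  have h : P j * P j = 1 := by
    have h1 := Matrix.mem_unitaryGroup_iff.1 (P j).2
    rw [Matrix.star_eq_conjTranspose, (hP j).eq] at h1
    exact Subtype.ext h1
  simp only [measuredOp]
  split_ifs <;> simp [h]

end Measured

end MonitoredCodes

/-! ### Equivalence of the three conditions -/

theorem mainTheorem1 {n k m : ℕ}
    -- a stabilizer code, with an encoding isometry of `k` logical qubits into `n` physical qubits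
    (S : Subgroup (QubitUnitary n)) (hS : IsStabilizerGroup S)
    (Ξ : Matrix (Bits n) (Bits k) ℂ) (hΞ : IsEncodingIsometry S Ξ)
    -- mutually commuting Pauli observables
    (P : Fin m → QubitUnitary n) (hP : ∀ j, P j ∈ pauliGroup n)
    (hPherm : ∀ j, (P j : Op n).IsHermitian) (hPcomm : ∀ i j, P i * P j = P j * P i)
    -- measurement outcomes, occurring with nonzero probability
    (outcome : Fin m → ℤˣ) (M : Fin m → QubitUnitary n) (hM : M = measuredOp P outcome)
    (hpossible : sqNorm (projectedChoi Ξ M) ≠ 0) :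
    List.TFAE [
      measuredGroup M ⊓ logicalGroup S ≤ S,
      ∀ ℓ ∈ logicalGroup S, ℓ ∉ S →
        ∃ ℓ' ∈ pauliCentralizer (measuredGroup M), LogicalEquiv S ℓ' ℓ,
      mutualInformation (postChoi Ξ M) = 2 * (k : ℝ)] := by
  have hSP := hS.le_pauliGroup
  have hKP : measuredGroup M ≤ pauliGroup n := by
    rw [measuredGroup, Subgroup.closure_le]
    rintro _ ⟨j, rfl⟩
    exact hM ▸ measuredOp_mem_pauliGroup hP outcome j
  have := finite_of_le_pauliGroup hSP
  have := Fintype.ofFinite S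
  have := finite_of_le_pauliGroup hKP
  have := Fintype.ofFinite (measuredGroup M)
  have hproj : measurementProj M = groupAverage (measuredGroup M) :=
    measurementProj_eq_groupAverage (hM ▸ measuredOp_commute hPcomm outcome)
      (hM ▸ measuredOp_mul_self hPherm outcome)
  have hne : groupAverage (measuredGroup M) * Ξ ≠ 0 := by
    intro h
    apply hpossible
    simp [sqNorm, Fintype.sum_prod_type, projectedChoi_apply, hproj, h]
  have hSΞ : groupAverage S * Ξ = Ξ :=
    groupAverage_eq_of_forall_mul_eq fun _ hs => mul_encoding hΞ hs
  have hΞS : Ξ.conjTranspose * groupAverage S = Ξ.conjTranspose := by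
    rw [← conjTranspose_groupAverage, ← Matrix.conjTranspose_mul, hSΞ]
  rw [mutualInformation_postChoi_eq_iff hpossible (by rw [hproj, conjTranspose_groupAverage])
    (by rw [hproj, groupAverage_mul_self]), hproj]
  tfae_have 1 → 2 := by
    intro h ℓ hℓ _
    obtain ⟨s, hs, hcomm⟩ := exists_mul_commute_of_commute_inf hSP hKP hℓ.1 fun u hu =>
      (Subgroup.mem_centralizer_iff.1 hℓ.2 u (h hu)).symm
    exact ⟨ℓ * s, ⟨mul_mem hℓ.1 (hSP hs), Subgroup.mem_centralizer_iff.2 fun u hu =>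
      (hcomm u hu).symm⟩, s, hs, rfl⟩
  tfae_have 2 → 1 := by
    rintro h u ⟨huK, huL⟩
    have huS := Subgroup.mem_centralizer_iff.1 huL.2
    obtain ⟨s, hs, c, hc⟩ := exists_mul_eq_smul_one_of_commute_pauliCentralizer hSP huL.1
      fun ℓ hℓ => by
        by_cases hℓS : ℓ ∈ S
        · exact (huS ℓ hℓS).symm
        · obtain ⟨_, hℓ', s, hs, rfl⟩ := h ℓ hℓ hℓS
          have h1 := Subgroup.mem_centralizer_iff.1 hℓ'.2 u huK
          rw [mul_assoc, huS s hs, ← mul_assoc, ← mul_assoc] at h1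
          exact mul_right_cancel h1
    -- The phase of `u * s` is `1` since `u` and `s` both fix the post-measurement state.
    have h1 : c • (groupAverage (measuredGroup M) * Ξ) = groupAverage (measuredGroup M) * Ξ := by
      conv_rhs => rw [← mul_encoding hΞ hs, ← groupAverage_mul huK, Matrix.mul_assoc,
        ← Matrix.mul_assoc (u : Op n), ← Submonoid.coe_mul, hc, Matrix.smul_mul, Matrix.one_mul,
        Matrix.mul_smul]
    have hc1 : c = 1 := by
      have : (c - 1) • (groupAverage (measuredGroup M) * Ξ) = 0 := by
        rw [sub_smul, h1, one_smul, sub_self]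
      exact sub_eq_zero.1 ((smul_eq_zero.1 this).resolve_right hne)
    have hus : u * s = 1 := Subtype.ext (by rw [hc, hc1, one_smul]; rfl)
    rw [eq_inv_of_mul_eq_one_left hus]
    exact inv_mem hs
  tfae_have 1 → 3 := by
    intro h
    have hterm (u : measuredGroup M) : ∃ c : ℂ,
        Ξ.conjTranspose * ((u : QubitUnitary n) : Op n) * Ξ = c • 1 := by
      by_cases hu : (u : QubitUnitary n) ∈ pauliCentralizer S
      · exact ⟨1, by rw [Matrix.mul_assoc, mul_encoding hΞ (h ⟨u.2, hu⟩), hΞ.isometry, one_smul]⟩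
      · refine ⟨0, ?_⟩
        rw [← hΞS, ← hSΞ, Matrix.mul_assoc, Matrix.mul_assoc, ← Matrix.mul_assoc _ _ Ξ,
          ← Matrix.mul_assoc _ _ Ξ, ← Matrix.mul_assoc _ _ (groupAverage S),
          groupAverage_mul_mul_groupAverage_eq_zero hSP (hKP u.2) hu, Matrix.zero_mul,
          Matrix.mul_zero, zero_smul]
    choose c hc using hterm
    refine ⟨(Fintype.card (measuredGroup M) : ℂ)⁻¹ * ∑ u, c u, ?_⟩
    rw [groupAverage, Matrix.mul_smul, Matrix.smul_mul, Matrix.mul_sum, Matrix.sum_mul,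
      Finset.sum_congr rfl fun u _ => hc u, ← Finset.sum_smul, smul_smul]
  tfae_have 3 → 1 := by
    rintro ⟨c, hc⟩ u ⟨huK, huL⟩
    have hc0 : c ≠ 0 := by
      rintro rfl
      apply hne
      exact groupAverage_mul_eq_zero (by rw [hc, zero_smul])
    have hsand : groupAverage S * groupAverage (measuredGroup M) * groupAverage S
        = c • groupAverage S := by
      rw [← encoding_mul_conjTranspose hΞ]
      calc Ξ * Ξ.conjTranspose * groupAverage (measuredGroup M) * (Ξ * Ξ.conjTranspose)
          = Ξ * (Ξ.conjTranspose * groupAverage (measuredGroup M) * Ξ) * Ξ.conjTranspose := by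
            simp only [Matrix.mul_assoc]
        _ = c • (Ξ * Ξ.conjTranspose) := by
            rw [hc, Matrix.mul_smul, Matrix.mul_one, Matrix.smul_mul]
    refine mem_of_mul_groupAverage_eq hSP huL.1 ?_ ?_
    · intro h0
      rw [h0, Matrix.zero_mul] at hSΞ
      exact hne (by rw [← hSΞ, Matrix.mul_zero])
    · refine smul_right_injective _ hc0 ?_
      change c • ((u : Op n) * groupAverage S) = c • groupAverage S
      rw [← Matrix.mul_smul, ← hsand, ← Matrix.mul_assoc, ← Matrix.mul_assoc,
        groupAverage_commute huL, Matrix.mul_assoc _ (u : Op n), mul_groupAverage huK]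
  tfae_finish
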